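/- Let $N$ be a finite set of players. A welfare function is a map $W:2^N\to\mathbb{R}$. A distribution rule is a map $f:N\times 2^N\to\mathbb{R}$ with $f(i,S)=0$ whenever $i\notin S$; no budget-balance is required. Let $\mathbb{W}$ be any set of welfare functions, and for each $W\in\mathbb{W}$ let $f^W$ be a distribution rule. A game in the class $\mathcal{G}(N,f^{\mathbb{W}},\mathbb{W})$ consists of a finite set $R$ of at least two resources, a local welfare function $W_r\in\mathbb{W}$ for each $r\in R$, and a nonempty action set $\mathcal{A}_i\subseteq 2^R$ for each $i\in N$. In the action profile $a=(a_i)_{i\in N}\in\prod_{i\in N}\mathcal{A}_i$ player $i$ has utility $$U_i(a)=\sum_{r\in a_i}f^{W_r}\bigl(i,\{j\in N: r\in a_j\}\bigr),$$ and $a$ is a pure Nash equilibrium if $U_i(b,a_{-i})\le U_i(a)$ for all $i\in N$ and $b\in\mathcal{A}_i$. A weight system $\omega=(\lambda,\Sigma)$ consists of weights $\lambda_i>0$ ($i\in N$) and an ordered partition $\Sigma=(S_1,\dots,S_m)$ of $N$. For nonempty $T\subseteq N$ let $\overline{T}=T\cap S_k$, where $k=\min\{j: S_j\cap T\neq\emptyset\}$.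 The generalized weighted Shapley value rule of a welfare function $W$ is $$f^{W}_{GWSV}[\omega](i,S)=\sum_{T\subseteq S:\ i\in\overline{T}}\frac{\lambda_i}{\sum_{j\in\overline{T}}\lambda_j}\sum_{Q\subseteq T}(-1)^{|T|-|Q|}W(Q).$$ Theorem. Every game in $\mathcal{G}(N,f^{\mathbb{W}},\mathbb{W})$ has a pure Nash equilibrium if and only if there is a single weight system $\omega$ such that for every $W\in\mathbb{W}$ $$f^W=f^{W'}_{GWSV}[\omega],\qquad\text{where } W'(S)=\sum_{i\in S}f^W(i,S)\text{ for all }S\subseteq N.$$ -/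

import Mathlib

namespace WelfareSharing

/-- A (local) welfare function: a real number for every set of players. -/
abbrev Welfare (N : Type*) : Type _ := Finset N → ℝ

/-- A (local) distribution rule: `f i S` is the share of player `i` when the players of `S` share
the welfare. Players outside `S` get nothing. The shares need not add up to any given welfare. -/
@[ext]
structure DistributionRule (N : Type*) where
  share : N → Finset N → ℝ
  share_eq_zero : ∀ i S, i ∉ S → share i S = 0

instance {N : Type*} : CoeFun (DistributionRule N) (fun _ => N → Finset N → ℝ) :=
  ⟨DistributionRule.share⟩

/-- The welfare that a distribution rule actually distributes. -/
def DistributionRule.groundWelfare {N : Type*} (f : DistributionRule N) : Welfare N :=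
  fun S => ∑ i ∈ S, f i S

/-- A welfare sharing game with player set `N`: a finite set of at least two resources, nonempty
sets of actions (an action is a set of resources), a local welfare function and a local distribution
rule at every resource, where equal local welfare functions come with equal distribution rules. -/
structure WelfareGame (N : Type*) where
  Resource : Type
  [fintypeResource : Fintype Resource]
  [decidableEqResource : DecidableEq Resource]
  one_lt_card : 1 < Fintype.card Resource
  actions : N → Set (Finset Resource)
  actions_nonempty : ∀ i, (actions i).Nonempty
  welfare : Resource → Welfare N
  rule : Resource → DistributionRule N
  rule_eq_of_welfare_eq : ∀ r r', welfare r = welfare r' → rule r = rule r'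

attribute [instance] WelfareGame.fintypeResource WelfareGame.decidableEqResource

namespace WelfareGame

variable {N : Type*} [Fintype N] (G : WelfareGame N)

/-- The set of players that have chosen the resource `r` in the action profile `a`. -/
def users (a : N → Finset G.Resource) (r : G.Resource) : Finset N :=
  Finset.univ.filter fun i => r ∈ a i

/-- The utility of player `i` in the action profile `a`. -/
def utility (i : N) (a : N → Finset G.Resource) : ℝ :=
  ∑ r ∈ a i, G.rule r i (G.users a r)

/-- `a` is a pure Nash equilibrium: an admissible action profile in which no player can increase
its utility by a unilateral change of its action. -/
def IsNashEquilibrium [DecidableEq N] (a : N → Finset G.Resource) : Prop :=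
  (∀ i, a i ∈ G.actions i) ∧
    ∀ i, ∀ b ∈ G.actions i, G.utility i (Function.update a i b) ≤ G.utility i a

end WelfareGame

/-- The class of all welfare sharing games with player set `N`, all of whose local welfare functions
`W` are in `𝕎`, with the distribution rule `f W` at every resource that has the welfare `W`. -/
def gameClass {N : Type*} (𝕎 : Set (Welfare N)) (f : 𝕎 → DistributionRule N) :
    Set (WelfareGame N) :=
  {G | ∀ r, ∃ h : G.welfare r ∈ 𝕎, G.rule r = f ⟨G.welfare r, h⟩}

/-- A weight system on `N`: positive weights and an ordered partition of `N`. -/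
structure WeightSystem (N : Type*) where
  weight : N → ℝ
  weight_pos : ∀ i, 0 < weight i
  numParts : ℕ
  part : Fin numParts → Finset N
  part_nonempty : ∀ k, (part k).Nonempty
  part_disjoint : ∀ k l, k ≠ l → Disjoint (part k) (part l)
  part_cover : ∀ i, ∃ k, i ∈ part k

open Classical in
/-- The members of `T` of highest priority: `T ∩ S_k` for the least `k` such that the part `S_k`
meets `T`. -/
noncomputable def WeightSystem.leaders {N : Type*} (ω : WeightSystem N) (T : Finset N) : Finset N :=
  T.filter fun i => ∃ k, IsLeast {j | (ω.part j ∩ T).Nonempty} k ∧ i ∈ ω.part k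

open Classical in
/-- The share of player `i` in `S` under the generalized weighted Shapley value of `W` with weight
system `ω`. -/
noncomputable def gwsvShare {N : Type*} (ω : WeightSystem N) (W : Welfare N) (i : N)
    (S : Finset N) : ℝ :=
  ∑ T ∈ S.powerset.filter (fun T => i ∈ ω.leaders T),
    ω.weight i / (∑ j ∈ ω.leaders T, ω.weight j) *
      ∑ R ∈ T.powerset, (-1 : ℝ) ^ (T.card - R.card) * W R

/-- The generalized weighted Shapley value distribution rule of `W` with weight system `ω`. -/
noncomputable def gwsv {N : Type*} (ω : WeightSystem N) (W : Welfare N) : DistributionRule N where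
  share := gwsvShare ω W
  share_eq_zero := by
    classical
    intro i S hi
    unfold gwsvShare
    rw [Finset.filter_false_of_mem, Finset.sum_empty]
    intro T hT h
    exact hi (Finset.mem_powerset.1 hT (Finset.mem_filter.1 h).1)

end WelfareSharing

namespace WelfareSharing

/-! ### Möbius coefficients of set functions -/

/-! Expand each rule in Möbius coefficients. It is a generalized weighted Shapley value of its own
ground welfare exactly when, in every `T`, the coefficients vanish off the leaders of `T` and are
proportional to the weights on them (`eq_gwsv_of_moebius` is the direction used).

Shapley values give equilibria: each rank has a potential. A deviation of `i` leaves the potentials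
of larger rank unchanged and changes that of its own rank by its utility gain over its weight
(`rankPotential_erase_of_lt`, `rankPotential_eq_share_add`). So a lexicographic maximizer, larger
ranks first, is an equilibrium.

Conversely, let every player choose between two actions, coded by a sign. An equilibrium is then a
sign vector `x` with `x a * (C x) a ≥ 0` for all `a`, where `C` is any chosen sum of signed
influence matrices (`exists_stable_of_sum`). Scaling and closedness extend this from integer
combinations to the real span, which contains the pairs of Möbius coefficients. Hence ratios of
coefficients are nonnegative, and their product along a closed walk is at least 1
(`one_le_prod_of_injOn`, `one_le_prod_of_closed`). Reversing the walk makes it equal to 1. So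
nonzero ratios are quotients of one weight function and zero ratios define a strict ranking
(`exists_weight_rank`). -/

/-- The coefficient of the unanimity game of `T` in the set function `W`. -/
noncomputable def moebius {N : Type*} (W : Welfare N) (T : Finset N) : ℝ :=
  ∑ R ∈ T.powerset, (-1 : ℝ) ^ (T.card - R.card) * W R

theorem moebius_insert {N : Type*} [DecidableEq N] (W : Welfare N) {a : N} {T : Finset N}
    (ha : a ∉ T) :
    moebius W (insert a T) = moebius (fun R => W (insert a R)) T - moebius W T := by
  unfold moebius
  rw [Finset.sum_powerset_insert ha, add_comm, sub_eq_add_neg, ← Finset.sum_neg_distrib]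
  congr 1
  · refine Finset.sum_congr rfl fun R hR => ?_
    have haR : a ∉ R := fun h => ha (Finset.mem_powerset.1 hR h)
    rw [Finset.card_insert_of_notMem ha, Finset.card_insert_of_notMem haR, Nat.add_sub_add_right]
  · refine Finset.sum_congr rfl fun R hR => ?_
    have := Finset.card_le_card (Finset.mem_powerset.1 hR)
    rw [Finset.card_insert_of_notMem ha, Nat.sub_add_comm this, pow_succ]
    ring

theorem sum_moebius {N : Type*} (W : Welfare N) (S : Finset N) :
    ∑ T ∈ S.powerset, moebius W T = W S := by
  classical
  induction S using Finset.induction_on generalizing W with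
  | empty => simp [moebius]
  | insert a S ha ih =>
    rw [Finset.sum_powerset_insert ha, ← ih fun R => W (insert a R), ← Finset.sum_add_distrib]
    refine Finset.sum_congr rfl fun T hT => ?_
    rw [moebius_insert W fun h => ha (Finset.mem_powerset.1 hT h)]
    ring

theorem moebius_share_eq_zero {N : Type*} (f : DistributionRule N) {i : N} {T : Finset N}
    (hi : i ∉ T) : moebius (f i) T = 0 := by
  refine Finset.sum_eq_zero fun R hR => ?_
  rw [f.share_eq_zero i R fun h => hi (Finset.mem_powerset.1 hR h), mul_zero]

theorem moebius_groundWelfare {N : Type*} [Fintype N] (f : DistributionRule N) (T : Finset N) :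
    moebius f.groundWelfare T = ∑ i, moebius (f i) T := by
  have h : ∀ R, f.groundWelfare R = ∑ i, f i R := fun R =>
    Finset.sum_subset (Finset.subset_univ R) fun i _ hi => f.share_eq_zero i R hi
  simp only [moebius, h, Finset.mul_sum]
  exact Finset.sum_comm

/-! ### Weight systems as weights and ranks -/

/-- The rank of a player is the index of the unique part containing it. -/
theorem WeightSystem.exists_rank {N : Type*} (ω : WeightSystem N) :
    ∃ h : N → Fin ω.numParts,
      ∀ (T : Finset N) (i : N), i ∈ ω.leaders T ↔ i ∈ T ∧ ∀ j ∈ T, h i ≤ h j := by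
  classical
  choose h hh using ω.part_cover
  have huniq : ∀ i k, i ∈ ω.part k → k = h i := fun i k hk => by
    by_contra hne
    exact Finset.disjoint_left.1 (ω.part_disjoint _ _ hne) hk (hh i)
  refine ⟨h, fun T i => ?_⟩
  simp only [WeightSystem.leaders, Finset.mem_filter]
  refine and_congr_right fun hiT => ⟨?_, fun hmin => ⟨h i, ⟨?_, ?_⟩, hh i⟩⟩
  · rintro ⟨k, hk, hik⟩ j hj
    rw [← huniq i k hik]
    exact hk.2 ⟨j, Finset.mem_inter.2 ⟨hh j, hj⟩⟩
  · exact ⟨i, Finset.mem_inter.2 ⟨hh i, hiT⟩⟩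
  · rintro k ⟨j, hj⟩
    rw [huniq j k (Finset.mem_inter.1 hj).1]
    exact hmin j (Finset.mem_inter.1 hj).2

/-- Ranks may leave gaps while parts must be nonempty, so the parts are indexed by the image of `h`,
enumerated in increasing order. -/
theorem exists_weightSystem {N : Type*} [Fintype N] (weight : N → ℝ) (hpos : ∀ i, 0 < weight i)
    (h : N → ℕ) :
    ∃ ω : WeightSystem N, ω.weight = weight ∧
      ∀ (T : Finset N) (i : N), i ∈ ω.leaders T ↔ i ∈ T ∧ ∀ j ∈ T, h i ≤ h j := by
  classical
  let e := (Finset.univ.image h).orderIsoOfFin rfl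
  have himg : ∀ i, h i ∈ Finset.univ.image h := fun i =>
    Finset.mem_image_of_mem h (Finset.mem_univ i)
  let ω : WeightSystem N :=
    { weight := weight
      weight_pos := hpos
      numParts := (Finset.univ.image h).card
      part := fun k => Finset.univ.filter fun i => h i = e k
      part_nonempty := fun k => by
        obtain ⟨i, -, hi⟩ := Finset.mem_image.1 (e k).2
        exact ⟨i, by simp [hi]⟩
      part_disjoint := fun k l hkl => by
        refine Finset.disjoint_left.2 fun i hk hl => hkl ?_
        simp only [Finset.mem_filter, Finset.mem_univ, true_and] at hk hl
        exact e.injective (Subtype.ext (hk.symm.trans hl))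
      part_cover := fun i => ⟨e.symm ⟨h i, himg i⟩, by simp⟩ }
  have hpart : ∀ i k, i ∈ ω.part k ↔ h i = e k := fun i k => by simp [ω]
  refine ⟨ω, rfl, fun T i => ?_⟩
  simp only [WeightSystem.leaders, Finset.mem_filter, hpart]
  refine and_congr_right fun hiT => ⟨?_, fun hmin => ⟨e.symm ⟨h i, himg i⟩, ⟨?_, ?_⟩, by simp⟩⟩
  · rintro ⟨k, hk, hik⟩ j hj
    have := hk.2 (show e.symm ⟨h j, himg j⟩ ∈ _ from
      ⟨j, Finset.mem_inter.2 ⟨(hpart _ _).2 (by simp), hj⟩⟩)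
    rw [← e.le_iff_le, e.apply_symm_apply] at this
    rw [hik]
    exact this
  · exact ⟨i, Finset.mem_inter.2 ⟨(hpart _ _).2 (by simp), hiT⟩⟩
  · rintro k ⟨j, hj⟩
    have h1 := (hpart _ _).1 (Finset.mem_inter.1 hj).1
    rw [← e.le_iff_le, e.apply_symm_apply]
    change h i ≤ e k
    rw [← h1]
    exact hmin j (Finset.mem_inter.1 hj).2

/-! ### Generalized weighted Shapley values have equilibria -/

theorem WelfareGame.utility_eq_sum {N : Type*} [Fintype N] (G : WelfareGame N) (i : N)
    (a : N → Finset G.Resource) : G.utility i a = ∑ r, G.rule r i (G.users a r) :=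
  Finset.sum_subset (Finset.subset_univ _) fun r _ hr =>
    (G.rule r).share_eq_zero i _ (by simpa [WelfareGame.users] using hr)

theorem WelfareGame.users_update_erase {N : Type*} [Fintype N] [DecidableEq N] (G : WelfareGame N)
    (a : N → Finset G.Resource) (i : N) (b : Finset G.Resource) (r : G.Resource) :
    (G.users (Function.update a i b) r).erase i = (G.users a r).erase i := by
  ext j
  by_cases h : j = i <;> simp [WelfareGame.users, h]

open Classical in
/-- The potential of the players of rank `k` at a resource with the generalized weighted Shapley
value of `W`. -/
noncomputable def rankPotential {N κ : Type*} (ω : WeightSystem N) (h : N → κ) (W : Welfare N)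
    (k : κ) (S : Finset N) : ℝ :=
  ∑ T ∈ S.powerset.filter (fun T => ∃ j ∈ ω.leaders T, h j = k),
    moebius W T / ∑ j ∈ ω.leaders T, ω.weight j

section

variable {N κ : Type*} [DecidableEq N] [Preorder κ] {ω : WeightSystem N} {h : N → κ}

/-- Split the sets `T` by whether `i` leads. If `i` does not lead but some leader has the rank of
`i`, then `i ∉ T`, so exactly the sets inside `S.erase i` remain. -/
theorem rankPotential_eq_share_add
    (hlead : ∀ (T : Finset N) (i : N), i ∈ ω.leaders T ↔ i ∈ T ∧ ∀ j ∈ T, h i ≤ h j)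
    (W : Welfare N) (i : N) (S : Finset N) :
    rankPotential ω h W (h i) S =
      (ω.weight i)⁻¹ * gwsv ω W i S + rankPotential ω h W (h i) (S.erase i) := by
  classical
  have hi := (ω.weight_pos i).ne'
  simp only [rankPotential, gwsv, gwsvShare]
  rw [Finset.mul_sum,
    ← Finset.sum_filter_add_sum_filter_not _ (fun T => i ∈ ω.leaders T), Finset.filter_filter,
    Finset.filter_filter]
  congr 1
  · refine Finset.sum_congr ?_ fun T _ => ?_
    · ext T
      simp only [Finset.mem_filter]
      exact and_congr_right fun _ => ⟨fun h => h.2, fun h => ⟨⟨i, h, rfl⟩, h⟩⟩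
    change _ = (ω.weight i)⁻¹ * (_ * moebius W T)
    field_simp
  · refine Finset.sum_congr ?_ fun _ _ => rfl
    ext T
    simp only [Finset.mem_filter, Finset.mem_powerset, Finset.subset_erase]
    constructor
    · rintro ⟨hTS, ⟨j, hj, hji⟩, hiT⟩
      refine ⟨⟨hTS, fun hT => hiT ((hlead T i).2 ⟨hT, ?_⟩)⟩, j, hj, hji⟩
      rw [← hji]
      exact ((hlead T j).1 hj).2
    · rintro ⟨⟨hTS, hiT⟩, hj⟩
      exact ⟨hTS, hj, fun hT => hiT ((hlead T i).1 hT).1⟩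

/-- A set whose leaders have rank `k` has no member of smaller rank, so it cannot contain `i`. -/
theorem rankPotential_erase_of_lt
    (hlead : ∀ (T : Finset N) (i : N), i ∈ ω.leaders T ↔ i ∈ T ∧ ∀ j ∈ T, h i ≤ h j)
    (W : Welfare N) {i : N} {k : κ} (hk : h i < k) (S : Finset N) :
    rankPotential ω h W k (S.erase i) = rankPotential ω h W k S := by
  classical
  refine Finset.sum_congr ?_ fun _ _ => rfl
  ext T
  simp only [Finset.mem_filter, Finset.mem_powerset, Finset.subset_erase]
  refine ⟨fun hT => ⟨hT.1.1, hT.2⟩, ?_⟩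
  rintro ⟨hTS, j, hj, rfl⟩
  exact ⟨⟨hTS, fun hi => hk.not_ge (((hlead T j).1 hj).2 i hi)⟩, j, hj, rfl⟩

end

theorem WelfareGame.exists_isNashEquilibrium_of_gwsv {N : Type*} [Fintype N] [DecidableEq N]
    (G : WelfareGame N) (ω : WeightSystem N) (V : G.Resource → Welfare N)
    (hV : ∀ r, G.rule r = gwsv ω (V r)) : ∃ a, G.IsNashEquilibrium a := by
  classical
  obtain ⟨h, hlead⟩ := ω.exists_rank
  -- The dual order makes the lexicographic comparison start with the largest rank.
  let Ψ : (N → Finset G.Resource) → Lex ((Fin ω.numParts)ᵒᵈ → ℝ) := fun a =>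
    toLex fun k => ∑ r, rankPotential ω h (V r) (OrderDual.ofDual k) (G.users a r)
  have hne : {a : N → Finset G.Resource | ∀ i, a i ∈ G.actions i}.Nonempty :=
    ⟨fun i => (G.actions_nonempty i).some, fun i => (G.actions_nonempty i).some_mem⟩
  obtain ⟨a, ha, hmax⟩ := Set.exists_max_image _ Ψ (Set.toFinite _) hne
  refine ⟨a, ha, fun i b hb => ?_⟩
  by_contra hlt
  rw [not_le] at hlt
  have hadm : ∀ j, Function.update a i b j ∈ G.actions j := fun j => by
    rcases eq_or_ne j i with rfl | hj
    · simpa using hb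
    · simpa [hj] using ha j
  refine (hmax _ hadm).not_gt ⟨OrderDual.toDual (h i), fun k hk => ?_, ?_⟩
  · refine Finset.sum_congr rfl fun r _ => ?_
    have hk' : h i < OrderDual.ofDual k := hk
    rw [← rankPotential_erase_of_lt hlead _ hk' (G.users a r),
      ← rankPotential_erase_of_lt hlead _ hk' (G.users (Function.update a i b) r),
      G.users_update_erase]
  · have key : ∀ c, ∑ r, rankPotential ω h (V r) (h i) (G.users c r) =
        (ω.weight i)⁻¹ * G.utility i c +
          ∑ r, rankPotential ω h (V r) (h i) ((G.users c r).erase i) := fun c => by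
      rw [G.utility_eq_sum, Finset.mul_sum, ← Finset.sum_add_distrib]
      refine Finset.sum_congr rfl fun r _ => ?_
      rw [rankPotential_eq_share_add hlead, hV]
    change ∑ r, rankPotential ω h (V r) (h i) (G.users a r) <
      ∑ r, rankPotential ω h (V r) (h i) (G.users (Function.update a i b) r)
    rw [key, key]
    simp only [G.users_update_erase]
    have := mul_lt_mul_of_pos_left hlt (inv_pos.2 (ω.weight_pos i))
    linarith

/-! ### Games in which every player has two actions -/

/-- The sign of a Boolean, `1` for `false` and `-1` for `true`. -/
def boolSign (b : Bool) : ℝ := if b then -1 else 1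

/-- The matrix with the entries `p` at `(i, j)` and `q` at `(j, i)`. -/
def pairMatrix {N : Type*} [DecidableEq N] (i j : N) (p q : ℝ) : Matrix N N ℝ :=
  Matrix.single i j p + Matrix.single j i q

/-- The change of the share of `i` when `j` joins `i` and the players of `K`. -/
def DistributionRule.influence {N : Type*} [DecidableEq N] (f : DistributionRule N) (i j : N)
    (K : Finset N) : ℝ :=
  f i (insert i (insert j K)) - f i (insert i K)

/-- The mutual influence of `i` and `j`, in the presence of `K`, as a matrix. -/
def DistributionRule.influenceMatrix {N : Type*} [DecidableEq N] (f : DistributionRule N) (i j : N)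
    (K : Finset N) : Matrix N N ℝ :=
  pairMatrix i j (f.influence i j K) (f.influence j i K)

theorem pairMatrix_mulVec {N : Type*} [Fintype N] [DecidableEq N] (i j : N) (p q : ℝ) (v : N → ℝ)
    (a : N) :
    (pairMatrix i j p q).mulVec v a =
      (if a = i then p * v j else 0) + (if a = j then q * v i else 0) := by
  simp [pairMatrix, Matrix.add_mulVec, Matrix.single_mulVec_eq, Pi.single_apply]

/-- The players in `K` together with `i` if `p` and `j` if `q`. -/
def optionalUsers {N : Type*} [DecidableEq N] (K : Finset N) (i j : N) (p q : Bool) : Finset N :=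
  (if p then {i} else ∅) ∪ ((if q then {j} else ∅) ∪ K)

theorem mem_optionalUsers {N : Type*} [DecidableEq N] {K : Finset N} {i j k : N} {p q : Bool} :
    k ∈ optionalUsers K i j p q ↔ (k = i ∧ p) ∨ (k = j ∧ q) ∨ k ∈ K := by
  cases p <;> cases q <;> simp [optionalUsers, or_left_comm]

/-- The left side is what `a` loses by flipping its choice at one pair of resources. Only `i` and
`j` can lose or gain: each is alone with `K` on one resource or joined by the other, and the product
of both signs and that of `s` tells which. -/
theorem influence_eq_share_sub {N : Type*} [Fintype N] [DecidableEq N] (f : DistributionRule N)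
    {i j : N} {K : Finset N} (hij : i ≠ j) (hi : i ∉ K) (hj : j ∉ K) (s : Bool) (x : N → Bool)
    (a : N) :
    ∑ b, f a (optionalUsers K i j (x i == b) (x j == xor b s)) -
        ∑ b, f a (optionalUsers K i j (Function.update x a (!x a) i == b)
          (Function.update x a (!x a) j == xor b s)) =
      boolSign (x a) *
        (boolSign s • f.influenceMatrix i j K).mulVec (fun c => boolSign (x c)) a := by
  have h0 : f i K = 0 := f.share_eq_zero _ _ hi
  have h1 : f j K = 0 := f.share_eq_zero _ _ hj
  have h2 : f i (insert j K) = 0 := f.share_eq_zero _ _ (by simp [hij, hi])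
  have h3 : f j (insert i K) = 0 := f.share_eq_zero _ _ (by simp [hij.symm, hj])
  rw [Matrix.smul_mulVec, Pi.smul_apply, DistributionRule.influenceMatrix, pairMatrix_mulVec]
  rcases eq_or_ne a i with rfl | hai
  · rw [if_pos rfl, if_neg hij]
    simp only [Function.update_self, Function.update_of_ne hij.symm]
    cases x a <;> cases x j <;> cases s <;>
      simp [optionalUsers, boolSign, DistributionRule.influence, h0, h2,
        Finset.insert_comm a j]
  rcases eq_or_ne a j with rfl | haj
  · rw [if_neg hai, if_pos rfl]
    simp only [Function.update_self, Function.update_of_ne hij]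
    cases x i <;> cases x a <;> cases s <;>
      simp [optionalUsers, boolSign, DistributionRule.influence, h1, h3,
        Finset.insert_comm a i]
  · simp [Function.update_of_ne hai.symm, Function.update_of_ne haj.symm, hai, haj]

theorem tendsto_floor_mul_div (t : ℝ) :
    Filter.Tendsto (fun n : ℕ => (⌊t * n⌋ : ℝ) / n) Filter.atTop (nhds t) := by
  have h1 : Filter.Tendsto (fun n : ℕ => t - 1 / (n : ℝ)) Filter.atTop (nhds t) := by
    simpa using tendsto_const_nhds.sub (tendsto_one_div_atTop_nhds_zero_nat (𝕜 := ℝ))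
  refine tendsto_of_tendsto_of_tendsto_of_le_of_le' h1 tendsto_const_nhds ?_ ?_ <;>
    filter_upwards [Filter.eventually_gt_atTop 0] with n hn
  · have hn' : (0 : ℝ) < n := Nat.cast_pos.2 hn
    rw [le_div_iff₀ hn', sub_mul, one_div_mul_cancel hn'.ne']
    exact (Int.sub_one_lt_floor _).le
  · exact (div_le_iff₀ (Nat.cast_pos.2 hn)).2 (Int.floor_le _)

/-- The matrices for which some sign vector agrees weakly with its image. -/
def stableMatrices (N : Type*) [Fintype N] : Set (Matrix N N ℝ) :=
  {c | ∃ x : N → Bool, ∀ a, 0 ≤ boolSign (x a) * c.mulVec (fun b => boolSign (x b)) a}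

/-- There are only finitely many sign vectors, and each one imposes closed conditions. -/
theorem isClosed_stableMatrices {N : Type*} [Fintype N] : IsClosed (stableMatrices N) := by
  have : stableMatrices N = ⋃ x : N → Bool, ⋂ a,
      {c | 0 ≤ boolSign (x a) * c.mulVec (fun b => boolSign (x b)) a} := by
    ext; simp [stableMatrices]
  rw [this]
  refine isClosed_iUnion_of_finite fun x => isClosed_iInter fun a => isClosed_le continuous_const ?_
  exact continuous_const.mul
    ((continuous_apply a).comp (continuous_id.matrix_mulVec continuous_const))

theorem smul_mem_stableMatrices {N : Type*} [Fintype N] {c : Matrix N N ℝ}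
    (hc : c ∈ stableMatrices N) {t : ℝ} (ht : 0 ≤ t) : t • c ∈ stableMatrices N := by
  obtain ⟨x, hx⟩ := hc
  refine ⟨x, fun a => ?_⟩
  rw [Matrix.smul_mulVec, Pi.smul_apply, smul_eq_mul, mul_left_comm]
  exact mul_nonneg ht (hx a)

/-- Sets without `i` contribute nothing. The signs on the right depend only on `K`, so the
coefficients of `i` and `j` are the same combination of influences and fit into one matrix identity.
-/
theorem moebius_share_insert_insert {N : Type*} [DecidableEq N] (f : DistributionRule N)
    {i j : N} {K : Finset N} (hij : i ≠ j) (hi : i ∉ K) (hj : j ∉ K) :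
    moebius (f i) (insert i (insert j K)) = moebius (f.influence i j) K := by
  have h : ∀ R ∈ K.powerset, f i R = 0 ∧ f i (insert j R) = 0 := fun R hR => by
    have : i ∉ R := fun h => hi (Finset.mem_powerset.1 hR h)
    exact ⟨f.share_eq_zero _ _ this, f.share_eq_zero _ _ (by simp [hij, this])⟩
  rw [moebius_insert _ (by simp [hij, hi]), moebius_insert _ hj, moebius_insert _ hj]
  simp only [moebius, ← Finset.sum_sub_distrib]
  refine Finset.sum_congr rfl fun R hR => ?_
  rw [(h R hR).1, (h R hR).2, DistributionRule.influence]
  ring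

/-- The matrices of mutual influence of two players under the rules in the range of `f`. -/
def influenceMatrices {N : Type*} [DecidableEq N] {𝕎 : Set (Welfare N)}
    (f : 𝕎 → DistributionRule N) : Set (Matrix N N ℝ) :=
  {c | ∃ W i j K, i ≠ j ∧ i ∉ K ∧ j ∉ K ∧ c = (f W).influenceMatrix i j K}

theorem pairMatrix_moebius_mem_span {N : Type*} [DecidableEq N] {𝕎 : Set (Welfare N)}
    (f : 𝕎 → DistributionRule N) (W : 𝕎) {i j : N} {T : Finset N} (hij : i ≠ j) (hi : i ∈ T) (hj : j ∈ T) :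
    pairMatrix i j (moebius (f W i) T) (moebius (f W j) T) ∈
      Submodule.span ℝ (influenceMatrices f) := by
  obtain ⟨K, hiK, hjK, rfl⟩ : ∃ K, i ∉ K ∧ j ∉ K ∧ T = insert i (insert j K) := by
    refine ⟨(T.erase i).erase j, by simp, by simp, ?_⟩
    rw [Finset.insert_erase (by simp [hij.symm, hj]), Finset.insert_erase hi]
  have h : pairMatrix i j (moebius ((f W).influence i j) K) (moebius ((f W).influence j i) K) =
      ∑ R ∈ K.powerset, (-1 : ℝ) ^ (K.card - R.card) • (f W).influenceMatrix i j R := by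
    ext a b
    simp [pairMatrix, moebius, DistributionRule.influenceMatrix, Matrix.sum_apply,
      Matrix.single_apply, Finset.sum_add_distrib]
  rw [moebius_share_insert_insert _ hij hiK hjK, Finset.insert_comm,
    moebius_share_insert_insert _ hij.symm hjK hiK, h]
  refine sum_mem fun R hR => Submodule.smul_mem _ _ (Submodule.subset_span ?_)
  rw [Finset.mem_powerset] at hR
  exact ⟨W, i, j, R, hij, fun h => hiK (hR h), fun h => hjK (hR h), rfl⟩

section

variable {N : Type*} [Fintype N] [DecidableEq N] {𝕎 : Set (Welfare N)}

/-- The game with a pair of resources for every `p : Fin m`: the players of `K p` always use both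
of them, while `i p` and `j p` always use exactly one of the two, and it depends on `s p` which of
their actions bring them together. -/
def pairGame (f : 𝕎 → DistributionRule N) {m : ℕ} (hm : 0 < m) (W : Fin m → 𝕎) (i j : Fin m → N)
    (K : Fin m → Finset N) (s : Fin m → Bool) : WelfareGame N where
  Resource := Fin m × Bool
  one_lt_card := by simp; omega
  actions a := Set.range fun y : Bool => Finset.univ.filter fun r : Fin m × Bool =>
    a ∈ optionalUsers (K r.1) (i r.1) (j r.1) (a == i r.1 && y == r.2)
      (a == j r.1 && y == xor r.2 (s r.1))
  actions_nonempty _ := Set.range_nonempty _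
  welfare r := (W r.1).1
  rule r := f (W r.1)
  rule_eq_of_welfare_eq _ _ h := congrArg f (Subtype.ext h)

theorem exists_stable_of_sum {f : 𝕎 → DistributionRule N}
    (H : ∀ G ∈ gameClass 𝕎 f, ∃ a, G.IsNashEquilibrium a) {m : ℕ} (W : Fin m → 𝕎)
    (i j : Fin m → N) (K : Fin m → Finset N) (s : Fin m → Bool) (hij : ∀ p, i p ≠ j p)
    (hi : ∀ p, i p ∉ K p) (hj : ∀ p, j p ∉ K p) :
    ∃ x : N → Bool, ∀ a, 0 ≤ boolSign (x a) *
      (∑ p, boolSign (s p) • (f (W p)).influenceMatrix (i p) (j p) (K p)).mulVec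
        (fun c => boolSign (x c)) a := by
  -- A game needs two resources, so the empty sum is treated apart.
  rcases Nat.eq_zero_or_pos m with rfl | hm
  · exact ⟨fun _ => true, by simp⟩
  let G := pairGame f hm W i j K s
  obtain ⟨c, hc, hnash⟩ := H G fun r => ⟨(W r.1).2, rfl⟩
  choose x hx using hc
  let act : N → Bool → Finset G.Resource := fun a y =>
    Finset.univ.filter fun r : Fin m × Bool =>
      a ∈ optionalUsers (K r.1) (i r.1) (j r.1) (a == i r.1 && y == r.2)
        (a == j r.1 && y == xor r.2 (s r.1))
  have hact : ∀ a y (r : Fin m × Bool), r ∈ act a y ↔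
      (a = i r.1 ∧ y = r.2) ∨ (a = j r.1 ∧ y = xor r.2 (s r.1)) ∨ a ∈ K r.1 := fun a y r => by
    refine Finset.mem_filter.trans ((and_iff_right (Finset.mem_univ _)).trans ?_)
    rw [mem_optionalUsers]
    grind
  have utility_act : ∀ x : N → Bool, ∀ a, G.utility a (fun k => act k (x k)) =
      ∑ p, ∑ b, f (W p) a (optionalUsers (K p) (i p) (j p) (x (i p) == b)
        (x (j p) == xor b (s p))) := fun x a => by
    rw [G.utility_eq_sum, ← Fintype.sum_prod_type' (f := fun p b => f (W p) a
      (optionalUsers (K p) (i p) (j p) (x (i p) == b) (x (j p) == xor b (s p))))]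
    refine Finset.sum_congr rfl fun r _ => ?_
    change f (W r.1) a _ = _
    congr 1
    ext k
    simp only [WelfareGame.users, Finset.mem_filter, Finset.mem_univ, true_and]
    refine (hact k _ r).trans ?_
    rw [mem_optionalUsers]
    grind
  refine ⟨x, fun a => ?_⟩
  have hcx : c = fun k => act k (x k) := funext fun k => (hx k).symm
  have hup : Function.update c a (act a (!x a)) =
      fun k => act k (Function.update x a (!x a) k) := by
    funext k
    rcases eq_or_ne k a with rfl | hk
    · simp
    · simp [hk, hcx]
  have h := hnash a (act a (!x a)) ⟨_, rfl⟩
  rw [hup, hcx, utility_act, utility_act, ← sub_nonneg, ← Finset.sum_sub_distrib] at h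
  refine h.trans_eq ?_
  rw [Matrix.sum_mulVec, Finset.sum_apply, Finset.mul_sum]
  exact Finset.sum_congr rfl fun p _ =>
    influence_eq_share_sub (f (W p)) (hij p) (hi p) (hj p) (s p) x a

/-- Multiplicities come from repeating a pair of resources, negative signs from `s`. -/
theorem closure_influenceMatrices_subset {f : 𝕎 → DistributionRule N}
    (H : ∀ G ∈ gameClass 𝕎 f, ∃ a, G.IsNashEquilibrium a) :
    (AddSubgroup.closure (influenceMatrices f) : Set (Matrix N N ℝ)) ⊆ stableMatrices N := by
  intro c hc
  rw [SetLike.mem_coe, ← AddSubgroup.mem_toAddSubmonoid, AddSubgroup.closure_toAddSubmonoid] at hc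
  obtain ⟨l, hl, rfl⟩ := AddSubmonoid.exists_list_of_mem_closure hc
  have : ∀ p : Fin l.length, ∃ (W : 𝕎) (i j : N) (K : Finset N) (s : Bool), i ≠ j ∧ i ∉ K ∧ j ∉ K ∧
      l.get p = boolSign s • (f W).influenceMatrix i j K := fun p => by
    rcases hl _ (l.get_mem p) with ⟨W, i, j, K, hij, hi, hj, h⟩ | ⟨W, i, j, K, hij, hi, hj, h⟩
    · exact ⟨W, i, j, K, false, hij, hi, hj, by rw [h]; simp [boolSign]⟩
    · exact ⟨W, i, j, K, true, hij, hi, hj, by simp [boolSign, ← h]⟩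
  choose W i j K s hij hi hj h using this
  have hsum : l.sum = ∑ p, boolSign (s p) • (f (W p)).influenceMatrix (i p) (j p) (K p) := by
    rw [← Fin.sum_univ_getElem]
    exact Finset.sum_congr rfl fun p _ => h p
  rw [hsum]
  exact exists_stable_of_sum H W i j K s hij hi hj

/-- Real coefficients are limits of `⌊t * n⌋ / n`, and the factor `1 / n` does not affect stability.
-/
theorem span_influenceMatrices_subset {f : 𝕎 → DistributionRule N}
    (H : ∀ G ∈ gameClass 𝕎 f, ∃ a, G.IsNashEquilibrium a) :
    (Submodule.span ℝ (influenceMatrices f) : Set (Matrix N N ℝ)) ⊆ stableMatrices N := by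
  intro c hc
  obtain ⟨m, t, g, rfl⟩ := Submodule.mem_span_set'.1 hc
  have hlim : Filter.Tendsto (fun n : ℕ => ∑ i, ((⌊t i * n⌋ : ℝ) / n) • (g i : Matrix N N ℝ))
      Filter.atTop (nhds (∑ i, t i • (g i : Matrix N N ℝ))) := by
    refine tendsto_finsetSum _ fun i _ => Filter.Tendsto.smul_const ?_ _
    exact tendsto_floor_mul_div (t i)
  refine isClosed_stableMatrices.mem_of_tendsto hlim (Filter.Eventually.of_forall fun n => ?_)
  have : ∑ i, ((⌊t i * n⌋ : ℝ) / n) • (g i : Matrix N N ℝ) =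
      (n : ℝ)⁻¹ • ∑ i, ⌊t i * n⌋ • (g i : Matrix N N ℝ) := by
    rw [Finset.smul_sum]
    refine Finset.sum_congr rfl fun i _ => ?_
    rw [← Int.cast_smul_eq_zsmul ℝ, smul_smul, div_eq_inv_mul]
  rw [this]
  refine smul_mem_stableMatrices (closure_influenceMatrices_subset H ?_) (by positivity)
  exact sum_mem fun i _ => zsmul_mem (AddSubgroup.subset_closure (g i).2) _

end

/-! ### Cycles of influence -/

theorem boolSign_eq (b : Bool) : boolSign b = 1 ∨ boolSign b = -1 := by
  cases b <;> simp [boolSign]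

theorem pairMatrix_smul {N : Type*} [DecidableEq N] (i j : N) (p q t : ℝ) :
    t • pairMatrix i j p q = pairMatrix i j (t * p) (t * q) := by
  simp [pairMatrix, Matrix.smul_single]

/-- For negative `ρ` this is matching pennies: `i` wants to agree with `j`, who wants to differ. -/
theorem nonneg_of_pairMatrix_mem_stableMatrices {N : Type*} [Fintype N] [DecidableEq N] {i j : N}
    (hij : i ≠ j) {ρ : ℝ} (h : pairMatrix i j 1 ρ ∈ stableMatrices N) : 0 ≤ ρ := by
  obtain ⟨x, hx⟩ := h
  have hi := hx i
  have hj := hx j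
  rw [pairMatrix_mulVec] at hi hj
  simp only [if_true, hij, hij.symm, if_false] at hi hj
  rcases boolSign_eq (x i) with h | h <;> rcases boolSign_eq (x j) with h' | h' <;>
    rw [h, h'] at hi hj <;> linarith

theorem exists_prod_add_lt_one {n : ℕ} {ρ : ℕ → ℝ} (h : ∏ l ∈ Finset.range n, ρ l < 1) :
    ∃ δ > 0, ∏ l ∈ Finset.range n, (ρ l + δ) < 1 := by
  have hc : Continuous fun δ : ℝ => ∏ l ∈ Finset.range n, (ρ l + δ) := by fun_prop
  have h0 : ∀ᶠ δ in nhds (0 : ℝ), ∏ l ∈ Finset.range n, (ρ l + δ) < 1 :=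
    hc.continuousAt.eventually_lt continuousAt_const (by simpa using h)
  obtain ⟨δ, h1, h2⟩ := ((h0.filter_mono nhdsWithin_le_nhds).and
    (self_mem_nhdsWithin (s := Set.Ioi (0 : ℝ)))).exists
  exact ⟨δ, h2, h1⟩

/-- Along a simple cycle the product of the ratios of mutual influence is at least `1`. Otherwise
suitable multiples of the influences make every player of the cycle follow its successor, except
for one who avoids its successor. -/
theorem one_le_prod_of_injOn {N : Type*} [Fintype N] [DecidableEq N]
    {E : Submodule ℝ (Matrix N N ℝ)} (hE : (E : Set (Matrix N N ℝ)) ⊆ stableMatrices N) {n : ℕ}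
    {v : ℕ → N} {ρ : ℕ → ℝ} (hn : 0 < n) (hρ : ∀ l < n, 0 ≤ ρ l)
    (hmem : ∀ l < n, pairMatrix (v l) (v (l + 1)) 1 (ρ l) ∈ E) (hv : v n = v 0)
    (hinj : Set.InjOn v (Set.Iio n)) : 1 ≤ ∏ l ∈ Finset.range n, ρ l := by
  by_contra! hlt
  obtain ⟨δ, hδ, hprod⟩ := exists_prod_add_lt_one hlt
  -- The slack `δ` keeps all `t l` positive even if some `ρ l = 0`, and makes every player weigh its
  -- successor strictly more than its predecessor. At the closing vertex this uses `t n < 1 = t 0`.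
  set t : ℕ → ℝ := fun l => ∏ k ∈ Finset.range l, (ρ k + δ) with ht
  have ht_succ : ∀ l, t (l + 1) = t l * (ρ l + δ) := fun l => Finset.prod_range_succ _ _
  have ht_pos : ∀ l ≤ n, 0 < t l := fun l hl => Finset.prod_pos fun k hk => by
    have := hρ k (by rw [Finset.mem_range] at hk; omega)
    linarith
  set s : ℕ → ℝ := fun l => if l + 1 = n then -1 else 1 with hs
  have hs_eq : ∀ l, s l = 1 ∨ s l = -1 := fun l => by simp only [hs]; split_ifs <;> simp
  obtain ⟨x, hx⟩ := hE (sum_mem fun l hl => E.smul_mem (s l * t l) (hmem l (Finset.mem_range.1 hl)) :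
    ∑ l ∈ Finset.range n, (s l * t l) • pairMatrix (v l) (v (l + 1)) 1 (ρ l) ∈ E)
  set y : ℕ → ℝ := fun l => boolSign (x (v l)) with hy
  have hy_eq : ∀ l, y l = 1 ∨ y l = -1 := fun l => boolSign_eq _
  have hpred : ∀ m < n, ∃ p < n, (∀ l < n, v m = v (l + 1) ↔ l = p) ∧ t p * ρ p < t m := by
    rintro (_ | m) hm
    · refine ⟨n - 1, by omega, fun l hl => ⟨fun h => ?_, fun h => ?_⟩, ?_⟩
      · by_contra hne
        have := hinj (show 0 < n from hn) (show l + 1 < n by omega) h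
        omega
      · rw [h, Nat.sub_add_cancel hn, hv]
      · have h1 := ht_succ (n - 1)
        have h2 := ht_pos (n - 1) (by omega)
        rw [Nat.sub_add_cancel hn] at h1
        have h3 : t 0 = 1 := by simp [ht]
        have h4 : t n < 1 := hprod
        have h5 := mul_pos h2 hδ
        rw [h3]
        linarith
    · refine ⟨m, by omega, fun l hl => ⟨fun h => ?_, fun h => by rw [h]⟩, ?_⟩
      · rcases Nat.lt_or_ge (l + 1) n with h' | h'
        · have := hinj hm h' h
          omega
        · rw [show l + 1 = n by omega, hv] at h
          have := hinj hm hn h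
          omega
      · have h5 := mul_pos (ht_pos m (by omega)) hδ
        rw [ht_succ]
        linarith
  -- The successor term dominates the predecessor term, so it alone fixes the sign in the stability
  -- inequality.
  have hfollow : ∀ m < n, y (m + 1) = s m * y m := fun m hm => by
    obtain ⟨p, hp, hvp, hlt⟩ := hpred m hm
    have h := hx (v m)
    have hrow : (∑ l ∈ Finset.range n, (s l * t l) • pairMatrix (v l) (v (l + 1)) 1 (ρ l)).mulVec
        (fun b => boolSign (x b)) (v m) =
        s m * t m * y (m + 1) + s p * t p * (ρ p * y p) := by
      rw [Matrix.sum_mulVec, Finset.sum_apply]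
      have : ∀ l ∈ Finset.range n, ((s l * t l) • pairMatrix (v l) (v (l + 1)) 1 (ρ l)).mulVec
          (fun b => boolSign (x b)) (v m) = (if l = m then s l * t l * y (l + 1) else 0) +
            (if l = p then s l * t l * (ρ l * y l) else 0) := fun l hl => by
        rw [Finset.mem_range] at hl
        rw [Matrix.smul_mulVec, Pi.smul_apply, pairMatrix_mulVec, smul_eq_mul, mul_add]
        have h1 : v m = v l ↔ l = m := ⟨fun h => (hinj hm hl h).symm, fun h => by rw [h]⟩
        simp only [h1, hvp l hl, mul_ite, mul_zero, one_mul, hy]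
      rw [Finset.sum_congr rfl this, Finset.sum_add_distrib, Finset.sum_ite_eq',
        Finset.sum_ite_eq', if_pos (Finset.mem_range.2 hm), if_pos (Finset.mem_range.2 hp)]
    rw [hrow] at h
    change 0 ≤ y m * _ at h
    have h0 : 0 ≤ t p * ρ p := mul_nonneg (ht_pos p hp.le).le (hρ p hp)
    rcases hy_eq m with e1 | e1 <;> rcases hy_eq (m + 1) with e2 | e2 <;>
      rcases hy_eq p with e3 | e3 <;> rcases hs_eq m with e4 | e4 <;>
      rcases hs_eq p with e5 | e5 <;> simp only [e1, e2, e3, e4, e5] at h ⊢ <;> linarith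
  have hconst : ∀ l < n, y l = y 0 := fun l => by
    induction l with
    | zero => exact fun _ => rfl
    | succ l ih =>
      intro hl
      rw [hfollow l (by omega), ih (by omega)]
      simp [hs, hl.ne]
  -- The only negative sign sits on the closing edge, so going once around gives `y 0 = -y 0`.
  have hlast := hfollow (n - 1) (by omega)
  rw [hconst (n - 1) (by omega), Nat.sub_add_cancel hn] at hlast
  have hyn : y n = y 0 := by simp only [hy, hv]
  simp only [hs, Nat.sub_add_cancel hn, if_true, hyn] at hlast
  rcases hy_eq 0 with e | e <;> rw [e] at hlast <;> linarith

/-! ### Walks with gains -/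

section

variable {N : Type*} {R : N → N → ℝ → Prop}

/-- A repeated vertex cuts the walk into two shorter closed walks whose products multiply. -/
theorem one_le_prod_of_closed
    (hsimple : ∀ (n : ℕ) (v : ℕ → N) (ρ : ℕ → ℝ), 0 < n → (∀ l < n, R (v l) (v (l + 1)) (ρ l)) →
      v n = v 0 → Set.InjOn v (Set.Iio n) → 1 ≤ ∏ l ∈ Finset.range n, ρ l)
    (n : ℕ) (v : ℕ → N) (ρ : ℕ → ℝ) (hR : ∀ l < n, R (v l) (v (l + 1)) (ρ l)) (hv : v n = v 0) :
    1 ≤ ∏ l ∈ Finset.range n, ρ l := by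
  induction n using Nat.strong_induction_on generalizing v ρ with
  | _ n ih =>
    rcases Nat.eq_zero_or_pos n with rfl | hn
    · simp
    by_cases hinj : Set.InjOn v (Set.Iio n)
    · exact hsimple n v ρ hn hR hv hinj
    obtain ⟨a, b, hab, hb, hvab⟩ : ∃ a b, a < b ∧ b < n ∧ v a = v b := by
      simp only [Set.InjOn, not_forall] at hinj
      obtain ⟨a, ha, b, hb, h, hne⟩ := hinj
      rcases lt_or_gt_of_ne hne with h' | h'
      · exact ⟨a, b, h', hb, h⟩
      · exact ⟨b, a, h', ha, h.symm⟩
    obtain ⟨d, rfl⟩ := Nat.exists_eq_add_of_le hab.le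
    obtain ⟨e, rfl⟩ := Nat.exists_eq_add_of_le hb.le
    have h1 := ih d (by omega) (fun l => v (a + l)) (fun l => ρ (a + l))
      (fun l hl => hR (a + l) (by omega)) hvab.symm
    -- Reindexing that skips the loop from `a` to `a + d`.
    let σ : ℕ → ℕ := fun l => if l < a then l else l + d
    have h2 := ih (a + e) (by omega) (fun l => v (σ l)) (fun l => ρ (σ l))
      (fun l hl => by
        have hσ : v (σ (l + 1)) = v (σ l + 1) := by
          rcases lt_trichotomy (l + 1) a with h | h | h
          · simp [σ, h, show l < a by omega]
          · subst h
            simp [σ, hvab]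
          · simp [σ, show ¬ l + 1 < a by omega, show ¬ l < a by omega, Nat.add_right_comm]
        simp only [hσ]
        refine hR _ ?_
        simp only [σ]
        split_ifs <;> omega)
      (by
        have h0 : v (σ 0) = v 0 := by
          rcases Nat.eq_zero_or_pos a with rfl | h
          · simpa [σ] using hvab.symm
          · simp [σ, h]
        simp only [h0, ← hv]
        simp [σ, Nat.add_right_comm])
    have hprod : ∏ l ∈ Finset.range (a + d + e), ρ l =
        (∏ l ∈ Finset.range d, ρ (a + l)) * ∏ l ∈ Finset.range (a + e), ρ (σ l) := by
      have hlt : ∏ l ∈ Finset.range a, ρ (σ l) = ∏ l ∈ Finset.range a, ρ l :=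
        Finset.prod_congr rfl fun l hl => by simp [σ, Finset.mem_range.1 hl]
      have hge : ∀ l, ρ (σ (a + l)) = ρ (a + d + l) := fun l => by simp [σ, Nat.add_right_comm]
      simp only [Finset.prod_range_add, hlt, hge]
      ring
    rw [hprod]
    exact one_le_mul_of_one_le_of_one_le h1 h2

/-- Walks along the steps of `R`, with the product of the gains of their steps. -/
inductive Walk (R : N → N → ℝ → Prop) : N → N → ℝ → Prop
  | nil (i : N) : Walk R i i 1
  | cons {i j k : N} {ρ g : ℝ} : R i j ρ → Walk R j k g → Walk R i k (ρ * g)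

theorem Walk.single {i j : N} {ρ : ℝ} (h : R i j ρ) : Walk R i j ρ := by
  simpa using Walk.cons h (Walk.nil j)

theorem Walk.trans {i j k : N} {g g' : ℝ} (h : Walk R i j g) (h' : Walk R j k g') :
    Walk R i k (g * g') := by
  induction h with
  | nil => simpa using h'
  | cons hr _ ih => simpa [mul_assoc] using Walk.cons hr (ih h')

theorem Walk.nonneg (hR : ∀ i j ρ, R i j ρ → 0 ≤ ρ) {i j : N} {g : ℝ} (h : Walk R i j g) :
    0 ≤ g := by
  induction h with
  | nil => exact zero_le_one
  | cons hr _ ih => exact mul_nonneg (hR _ _ _ hr) ih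

theorem Walk.reverse (hrev : ∀ i j ρ, R i j ρ → ρ ≠ 0 → R j i ρ⁻¹) {i j : N} {g : ℝ}
    (h : Walk R i j g) (hg : g ≠ 0) : Walk R j i g⁻¹ := by
  induction h with
  | nil i => simpa using Walk.nil i
  | cons hr _ ih =>
    rw [mul_inv_rev]
    exact (ih (right_ne_zero_of_mul hg)).trans (.single (hrev _ _ _ hr (left_ne_zero_of_mul hg)))

theorem Walk.exists_seq {i k : N} {g : ℝ} (h : Walk R i k g) :
    ∃ (n : ℕ) (v : ℕ → N) (ρ : ℕ → ℝ), (∀ l < n, R (v l) (v (l + 1)) (ρ l)) ∧ v 0 = i ∧ v n = k ∧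
      ∏ l ∈ Finset.range n, ρ l = g := by
  induction h with
  | nil i => exact ⟨0, fun _ => i, fun _ => 1, by simp⟩
  | @cons i j k ρ₀ g hr _ ih =>
    obtain ⟨n, v, ρ, hv, h0, hn, hg⟩ := ih
    refine ⟨n + 1, fun l => Nat.casesOn l i v, fun l => Nat.casesOn l ρ₀ ρ, ?_, rfl, hn, ?_⟩
    · rintro (_ | l) hl
      · simpa [h0] using hr
      · exact hv l (by omega)
    · rw [Finset.prod_range_succ', mul_comm, ← hg]
      rfl

/-- If the gains of all closed walks are `1`, then there are weights and ranks such that the steps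
of nonzero gain preserve the rank and multiply the weight by their gain, while the steps of gain
zero increase the rank. -/
theorem exists_weight_rank [Fintype N] (hR : ∀ i j ρ, R i j ρ → 0 ≤ ρ)
    (hrev : ∀ i j ρ, R i j ρ → ρ ≠ 0 → R j i ρ⁻¹) (hone : ∀ i g, Walk R i i g → g = 1) :
    ∃ (weight : N → ℝ) (h : N → ℕ), (∀ i, 0 < weight i) ∧ ∀ i j ρ, R i j ρ →
      (ρ = 0 → h i < h j) ∧ (ρ ≠ 0 → h i = h j ∧ weight j = ρ * weight i) := by
  classical
  let Reach : N → N → Prop := fun i j => ∃ g, Walk R i j g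
  have hrefl : ∀ i, Reach i i := fun i => ⟨1, .nil i⟩
  have htrans : ∀ {i j k}, Reach i j → Reach j k → Reach i k := fun ⟨_, h⟩ ⟨_, h'⟩ =>
    ⟨_, h.trans h'⟩
  let S : Setoid N :=
    { r := fun i j => Reach i j ∧ Reach j i
      iseqv := ⟨fun i => ⟨hrefl i, hrefl i⟩, fun h => ⟨h.2, h.1⟩, fun h h' =>
        ⟨htrans h.1 h'.1, htrans h'.2 h.2⟩⟩ }
  -- One base point per class of mutual reachability; the weight of `i` is the gain of a walk from
  -- its base point.
  let rep : N → N := fun i => (Quotient.mk S i).out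
  have hrep : ∀ i, Reach (rep i) i ∧ Reach i (rep i) := fun i => Quotient.mk_out (s := S) i
  choose weight hweight using fun i => (hrep i).1
  -- The rank counts the players strictly upstream of `i`.
  refine ⟨weight, fun i => (Finset.univ.filter fun k => Reach k i ∧ ¬ Reach i k).card, fun i => ?_,
    fun i j ρ hij => ⟨?_, fun hρ => ⟨?_, ?_⟩⟩⟩
  · obtain ⟨g, hg⟩ := (hrep i).2
    have h1 := hone _ _ ((hweight i).trans hg)
    refine lt_of_le_of_ne ((hweight i).nonneg hR) fun h0 => ?_
    rw [← h0, zero_mul] at h1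
    exact zero_ne_one h1
  · rintro rfl
    have hij' : Reach i j := ⟨_, .single hij⟩
    -- A way back would close a walk of gain zero.
    have hji : ¬ Reach j i := fun ⟨g, hg⟩ => by
      have := hone _ _ (Walk.cons hij hg)
      rw [zero_mul] at this
      exact zero_ne_one this
    refine Finset.card_lt_card (Finset.ssubset_iff_of_subset ?_ |>.2 ⟨i, ?_, ?_⟩)
    · intro k
      simp only [Finset.mem_filter, Finset.mem_univ, true_and]
      exact fun hk => ⟨htrans hk.1 hij', fun h => hji (htrans h hk.1)⟩
    · simp [hij', hji]
    · simp
  · have hij' : Reach i j := ⟨_, .single hij⟩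
    have hji : Reach j i := ⟨_, .single (hrev _ _ _ hij hρ)⟩
    refine congrArg Finset.card (Finset.filter_congr fun k _ => ?_)
    exact ⟨fun hk => ⟨htrans hk.1 hij', fun h => hk.2 (htrans hij' h)⟩,
      fun hk => ⟨htrans hk.1 hji, fun h => hk.2 (htrans hji h)⟩⟩
  · have hij' : Reach i j := ⟨_, .single hij⟩
    have hji : Reach j i := ⟨_, .single (hrev _ _ _ hij hρ)⟩
    have hreq : rep i = rep j := congrArg Quotient.out (Quotient.sound (s := S) ⟨hij', hji⟩)
    obtain ⟨g, hg⟩ := (hrep j).2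
    have h1 := hone _ _ ((hweight j).trans hg)
    -- Two closed walks share the return to the base point; cancelling its gain compares the weights
    -- of `i` and `j`.
    have h2 := hone _ _ (((hreq ▸ hweight i).trans (.single hij)).trans hg)
    have hg0 : g ≠ 0 := right_ne_zero_of_mul (h1 ▸ one_ne_zero)
    rw [mul_comm ρ]
    exact mul_right_cancel₀ hg0 (h1.trans h2.symm)

end

/-! ### Equilibria force generalized weighted Shapley values -/

/-- In some set, some rule gives the players `i` and `j` Möbius coefficients of ratio `1 : ρ`. -/
def CoefficientRatio {N : Type*} {𝕎 : Set (Welfare N)} (f : 𝕎 → DistributionRule N) (i j : N)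
    (ρ : ℝ) : Prop :=
  i ≠ j ∧ ∃ W T, i ∈ T ∧ j ∈ T ∧ moebius (f W i) T ≠ 0 ∧
    moebius (f W j) T = ρ * moebius (f W i) T

theorem CoefficientRatio.symm {N : Type*} {𝕎 : Set (Welfare N)} {f : 𝕎 → DistributionRule N}
    {i j : N} {ρ : ℝ} (h : CoefficientRatio f i j ρ) (hρ : ρ ≠ 0) : CoefficientRatio f j i ρ⁻¹ := by
  obtain ⟨hij, W, T, hi, hj, h0, h⟩ := h
  refine ⟨hij.symm, W, T, hj, hi, ?_, ?_⟩
  · rw [h]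
    exact mul_ne_zero hρ h0
  · rw [h, inv_mul_cancel_left₀ hρ]

theorem CoefficientRatio.pairMatrix_mem_span {N : Type*} [DecidableEq N] {𝕎 : Set (Welfare N)}
    {f : 𝕎 → DistributionRule N} {i j : N} {ρ : ℝ} (h : CoefficientRatio f i j ρ) :
    pairMatrix i j 1 ρ ∈ Submodule.span ℝ (influenceMatrices f) := by
  obtain ⟨hij, W, T, hi, hj, h0, h⟩ := h
  have := Submodule.smul_mem _ (moebius (f W i) T)⁻¹ (pairMatrix_moebius_mem_span f W hij hi hj)
  rwa [pairMatrix_smul, h, inv_mul_cancel₀ h0, mul_comm ρ, inv_mul_cancel_left₀ h0] at this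

theorem exists_weight_rank_of_equilibria {N : Type*} [Fintype N] [DecidableEq N]
    {𝕎 : Set (Welfare N)} {f : 𝕎 → DistributionRule N}
    (H : ∀ G ∈ gameClass 𝕎 f, ∃ a, G.IsNashEquilibrium a) :
    ∃ (weight : N → ℝ) (h : N → ℕ), (∀ i, 0 < weight i) ∧ ∀ i j ρ, CoefficientRatio f i j ρ →
      (ρ = 0 → h i < h j) ∧ (ρ ≠ 0 → h i = h j ∧ weight j = ρ * weight i) := by
  have hspan := span_influenceMatrices_subset H
  have hnonneg : ∀ i j ρ, CoefficientRatio f i j ρ → 0 ≤ ρ := fun i j ρ h =>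
    nonneg_of_pairMatrix_mem_stableMatrices h.1 (hspan h.pairMatrix_mem_span)
  have hrev : ∀ i j ρ, CoefficientRatio f i j ρ → ρ ≠ 0 → CoefficientRatio f j i ρ⁻¹ :=
    fun _ _ _ h => h.symm
  have hle : ∀ i g, Walk (CoefficientRatio f) i i g → 1 ≤ g := fun i g hg => by
    obtain ⟨n, v, ρ, hv, h0, hn, rfl⟩ := hg.exists_seq
    exact one_le_prod_of_closed (fun n v ρ hn hv => one_le_prod_of_injOn hspan hn
      (fun l hl => hnonneg _ _ _ (hv l hl)) fun l hl => (hv l hl).pairMatrix_mem_span)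
      n v ρ hv (hn.trans h0.symm)
  refine exists_weight_rank hnonneg hrev fun i g hg => (hle i g hg).antisymm' ?_
  have hpos : 0 < g := zero_lt_one.trans_le (hle i g hg)
  -- The reversed walk is closed too, so its gain `g⁻¹` is at least 1.
  exact (one_le_inv₀ hpos).1 (hle i _ (hg.reverse hrev hpos.ne'))

theorem eq_gwsv_of_moebius {N : Type*} [Fintype N] (f : DistributionRule N) (ω : WeightSystem N)
    (h : ∀ T i, (i ∈ ω.leaders T → moebius (f i) T =
      ω.weight i / (∑ j ∈ ω.leaders T, ω.weight j) * ∑ j, moebius (f j) T) ∧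
      (i ∉ ω.leaders T → moebius (f i) T = 0)) :
    f = gwsv ω f.groundWelfare := by
  classical
  ext i S
  change f i S = gwsvShare ω f.groundWelfare i S
  rw [← sum_moebius (f i) S, gwsvShare, Finset.sum_filter]
  refine Finset.sum_congr rfl fun T _ => ?_
  change _ = ite _ (_ * moebius f.groundWelfare T) _
  rw [moebius_groundWelfare]
  split_ifs with hi
  · exact (h T i).1 hi
  · exact (h T i).2 hi

/-- Compare all coefficients in `T` with a nonzero one, that of `p`. Zero coefficients belong to
ranks above that of `p`, nonzero ones to the rank of `p` in proportion to the weights, so the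
leaders are exactly the players with nonzero coefficient. -/
theorem exists_gwsv_of_equilibria {N : Type*} [Fintype N] [DecidableEq N]
    {𝕎 : Set (Welfare N)} {f : 𝕎 → DistributionRule N}
    (H : ∀ G ∈ gameClass 𝕎 f, ∃ a, G.IsNashEquilibrium a) :
    ∃ ω : WeightSystem N, ∀ W : 𝕎, f W = gwsv ω (f W).groundWelfare := by
  obtain ⟨weight, h, hpos, hR⟩ := exists_weight_rank_of_equilibria H
  obtain ⟨ω, hω, hlead⟩ := exists_weightSystem weight hpos h
  refine ⟨ω, fun W => eq_gwsv_of_moebius _ _ fun T => ?_⟩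
  by_cases h0 : ∀ i, moebius (f W i) T = 0
  · simp [h0]
  push Not at h0
  obtain ⟨p, hp⟩ := h0
  have hpT : p ∈ T := by
    by_contra hpT
    exact hp (moebius_share_eq_zero _ hpT)
  have hj : ∀ j ∈ T, (moebius (f W j) T = 0 → h p < h j) ∧ (moebius (f W j) T ≠ 0 →
      h p = h j ∧ moebius (f W j) T = moebius (f W p) T / weight p * weight j) := fun j hj => by
    rcases eq_or_ne p j with rfl | hne
    · exact ⟨fun h => absurd h hp, fun _ => ⟨rfl, (div_mul_cancel₀ _ (hpos p).ne').symm⟩⟩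
    · obtain ⟨h1, h2⟩ := hR p j (moebius (f W j) T / moebius (f W p) T)
        ⟨hne, W, T, hpT, hj, hp, (div_mul_cancel₀ _ hp).symm⟩
      refine ⟨fun h => h1 (by rw [h, zero_div]), fun h => ?_⟩
      obtain ⟨h3, h4⟩ := h2 (div_ne_zero h hp)
      refine ⟨h3, ?_⟩
      rw [h4]
      have := (hpos p).ne'
      field_simp
  have hmem : ∀ i, i ∈ ω.leaders T ↔ moebius (f W i) T ≠ 0 := fun i => by
    rw [hlead]
    refine ⟨fun hi h => ((hj i hi.1).1 h).not_ge (hi.2 p hpT), fun hi => ?_⟩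
    have hiT : i ∈ T := by
      by_contra hiT
      exact hi (moebius_share_eq_zero _ hiT)
    refine ⟨hiT, fun j hjT => ?_⟩
    rw [← ((hj i hiT).2 hi).1]
    rcases eq_or_ne (moebius (f W j) T) 0 with h | h
    · exact ((hj j hjT).1 h).le
    · exact ((hj j hjT).2 h).1.le
  have hval : ∀ i ∈ ω.leaders T, moebius (f W i) T = moebius (f W p) T / weight p * weight i :=
    fun i hi => ((hj i ((hlead T i).1 hi).1).2 ((hmem i).1 hi)).2
  refine fun i => ⟨fun hi => ?_, fun hi => by_contra fun h => hi ((hmem i).2 h)⟩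
  have hsum : ∑ j, moebius (f W j) T = moebius (f W p) T / weight p *
      ∑ j ∈ ω.leaders T, ω.weight j := by
    rw [hω, Finset.mul_sum, ← Finset.sum_congr rfl hval]
    exact (Finset.sum_subset (Finset.subset_univ _) fun j _ hj =>
      by_contra fun h => hj ((hmem j).2 h)).symm
  have hne : ∑ j ∈ ω.leaders T, ω.weight j ≠ 0 :=
    (Finset.sum_pos (fun j _ => ω.weight_pos j) ⟨i, hi⟩).ne'
  rw [hsum, hval i hi, hω, mul_left_comm, ← hω, div_mul_cancel₀ _ hne]

end WelfareSharing

theorem theorem1 {N : Type*} [Fintype N] [DecidableEq N]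
    (𝕎 : Set (WelfareSharing.Welfare N))
    (f : 𝕎 → WelfareSharing.DistributionRule N) :
    (∀ G ∈ WelfareSharing.gameClass 𝕎 f, ∃ a, G.IsNashEquilibrium a) ↔
      ∃ ω : WelfareSharing.WeightSystem N,
        ∀ W : 𝕎, f W = WelfareSharing.gwsv ω (f W).groundWelfare := by
  refine ⟨WelfareSharing.exists_gwsv_of_equilibria, ?_⟩
  rintro ⟨ω, hω⟩ G hG
  choose hmem hrule using hG
  exact G.exists_isNashEquilibrium_of_gwsv ω _ fun r => (hrule r).trans (hω _)
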